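/- For a base $Q$ with $|Q|<1$ put $(A;Q)_k=\prod_{i=0}^{k-1}(1-AQ^i)$ for integers $k\ge 0$ and $(A;Q)_\infty=\prod_{i\ge 0}(1-AQ^i)$. Let $q\ne 0$ be a complex number, fix a value of $\log q$, and write $q^{\alpha}=e^{\alpha\log q}$ for $\alpha\in\mathbb C$. For complex $\beta,\kappa$ with $|q^\beta|<1$ put $$(A;q^\beta)_\kappa=\frac{(A;q^\beta)_\infty}{(Aq^{\beta\kappa};q^\beta)_\infty},\qquad \frac1{(A;q^\beta)_\kappa}=\frac{(Aq^{\beta\kappa};q^\beta)_\infty}{(A;q^\beta)_\infty}\quad\text{if }(A;q^\beta)_\infty\neq0 .$$ For an integer $m\ge 1$, $\mathbf j=(j_1,\dots,j_m)\in\mathbb Z_{\ge 0}^m$ and $0<|Q|<1$ put $|\mathbf j|=j_1+\dots+j_m$ and $$T_m(Q,b;\mathbf j)=\prod_{1\le r<s\le m}\frac{1-Q^{m(j_r-j_s)+r-s}}{1-Q^{r-s}}\ \prod_{r=1}^m\frac1{(Q^r;Q)_{mj_r}}\ b^{m|\mathbf j|}\ Q^{2m\sum_{r=1}^m (r-1)j_r-m(m-1)|\mathbf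 j|+\sum_{r=1}^m\binom{mj_r+1}{2}} .$$ Let $n,m\ge 1$ be integers and $a,b\in\mathbb C$. (i) Let $h,t\in\mathbb C$ with $|q^h|<1$, $|q^t|<1$, $|q^{ht}|<1$, and suppose that $((-aq^h)^n;q^{hn})_\infty\ne 0$ and $((-bq^t)^m;q^{tm})_\infty\neq 0$. Then both series below converge absolutely, and $$\big((-aq^h)^n;q^{hn}\big)_\infty\sum_{\mathbf j\in\mathbb Z_{\ge 0}^m}\frac{T_m(q^t,b;\mathbf j)}{\big((-aq^h)^n;q^{hn}\big)_{tm|\mathbf j|}} =\big((-bq^t)^m;q^{tm}\big)_\infty\sum_{\mathbf k\in\mathbb Z_{\ge 0}^n}\frac{T_n(q^h,a;\mathbf k)}{\big((-bq^t)^m;q^{tm}\big)_{hn|\mathbf k|}} .$$ (ii) Let $t\in\mathbb C$ with $|q|<1$ and $|q^t|<1$, and suppose that $((-aq)^n;q^{n})_\infty\ne 0$ and $((-bq)^m;q^{m})_\infty\neq 0$. Then both series below converge absolutely, and $$\big((-aq)^n;q^{n}\big)_\infty\sum_{\mathbf j\in\mathbb Z_{\ge 0}^m}\frac{T_m(q,b;\mathbf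 j)}{\big((-aq)^n;q^{n}\big)_{tm|\mathbf j|}} =\big((-bq)^m;q^{m}\big)_\infty\sum_{\mathbf k\in\mathbb Z_{\ge 0}^n}\frac{T_n(q,a;\mathbf k)}{\big((-bq)^m;q^{m}\big)_{tn|\mathbf k|}} .$$ -/

import Mathlib

/-- The power `q ^ α`, where `L` is the chosen value of `log q`, i.e. `q = exp L`. -/
noncomputable def qPow (L α : ℂ) : ℂ := Complex.exp (α * L)

/-- The finite `q`-rising factorial `(A; Q)_k = (1 - A) (1 - A Q) ⋯ (1 - A Q ^ (k - 1))`. -/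
noncomputable def qFac (A Q : ℂ) (k : ℕ) : ℂ := ∏ i ∈ Finset.range k, (1 - A * Q ^ i)

/-- The infinite `q`-rising factorial `(A; Q)_∞ = ∏_{i ≥ 0} (1 - A Q ^ i)`. -/
noncomputable def qFacInf (A Q : ℂ) : ℂ := ∏' i : ℕ, (1 - A * Q ^ i)

/-- For a base of modulus less than one the infinite product converges. -/
theorem multipliable_qFacInf (A Q : ℂ) (hQ : ‖Q‖ < 1) :
    Multipliable (fun i : ℕ => 1 - A * Q ^ i) := by
  have h : Summable (fun i : ℕ => ‖-(A * Q ^ i)‖) := by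
    simp only [norm_neg, norm_mul, norm_pow]
    exact (summable_geometric_of_lt_one (norm_nonneg Q) hQ).mul_left _
  simpa [sub_eq_add_neg] using multipliable_one_add_of_summable h

/-- The `q`-rising factorial `(A; q ^ β)_κ` with a complex index `κ`, defined as
`(A; q ^ β)_∞ / (A q ^ (β κ); q ^ β)_∞`, where `L` is the chosen value of `log q`. -/
noncomputable def qFacC (L A β κ : ℂ) : ℂ :=
  qFacInf A (qPow L β) / qFacInf (A * qPow L (β * κ)) (qPow L β)

/-- The Vandermonde factor of type `A`
`∏_{r < s} (1 - Q ^ (m (j_r - j_s) + r - s)) / (1 - Q ^ (r - s))`. -/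
noncomputable def vandermondeA (m : ℕ) (Q : ℂ) (j : Fin m → ℕ) : ℂ :=
  ∏ r : Fin m, ∏ s ∈ Finset.Ioi r,
    (1 - Q ^ ((m : ℤ) * ((j r : ℤ) - (j s : ℤ)) + (((r : ℕ) : ℤ) - ((s : ℕ) : ℤ)))) /
      (1 - Q ^ (((r : ℕ) : ℤ) - ((s : ℕ) : ℤ)))

/-- The quadratic exponent
`2 m ∑_r (r - 1) j_r - m (m - 1) |j| + ∑_r binom(m j_r + 1, 2)`, the sums being over
`r = 1, …, m`. An index `r : Fin m` starts at `0` and stands for `r + 1`. -/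
def quadExponent (m : ℕ) (j : Fin m → ℕ) : ℤ :=
  2 * (m : ℤ) * (∑ r : Fin m, ((r : ℕ) : ℤ) * (j r : ℤ))
    - (m : ℤ) * ((m : ℤ) - 1) * (∑ r : Fin m, (j r : ℤ))
    + ∑ r : Fin m, (((m * j r + 1).choose 2 : ℕ) : ℤ)

/-- The part of the summand that involves only one base `Q`: the Vandermonde factor, times
`∏_{r = 1}^m 1 / (Q ^ r; Q)_{m j_r}`, times `b ^ (m |j|)`, times `Q` to the quadratic exponent. -/
noncomputable def termA (m : ℕ) (Q b : ℂ) (j : Fin m → ℕ) : ℂ :=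
  vandermondeA m Q j
    * (∏ r : Fin m, 1 / qFac (Q ^ ((r : ℕ) + 1)) Q (m * j r))
    * b ^ (m * ∑ r, j r)
    * Q ^ quadExponent m j

open Filter Topology

theorem one_sub_mul_pow_ne_zero {Q : ℂ} (hQ : ‖Q‖ < 1) (k : ℕ) : 1 - Q * Q ^ k ≠ 0 := by
  rw [← pow_succ', sub_ne_zero]
  intro h
  have := pow_lt_one₀ (norm_nonneg Q) hQ (Nat.succ_ne_zero k)
  rw [← norm_pow, ← h, norm_one] at this
  exact lt_irrefl _ this

theorem qFac_self_ne_zero {Q : ℂ} (hQ : ‖Q‖ < 1) (k : ℕ) : qFac Q Q k ≠ 0 :=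
  Finset.prod_ne_zero_iff.2 fun i _ => one_sub_mul_pow_ne_zero hQ i

theorem qFac_add (A Q : ℂ) (r k : ℕ) : qFac A Q (r + k) = qFac A Q r * qFac (A * Q ^ r) Q k := by
  simp only [qFac, Finset.prod_range_add, pow_add, mul_assoc]

/-- The coefficient `Q ^ binom(k, 2) / (Q; Q)_k` of Euler's expansion of `(-z; Q)_∞`. -/
noncomputable def eulerCoeff (Q : ℂ) (k : ℕ) : ℂ := Q ^ k.choose 2 / qFac Q Q k

/-- Euler's series `∑ Q ^ binom(k, 2) z ^ k / (Q; Q)_k`. -/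
noncomputable def eulerSum (Q z : ℂ) : ℂ := ∑' k : ℕ, eulerCoeff Q k * z ^ k

theorem eulerCoeff_zero (Q : ℂ) : eulerCoeff Q 0 = 1 := by simp [eulerCoeff, qFac]

theorem eulerCoeff_succ {Q : ℂ} (hQ : ‖Q‖ < 1) (k : ℕ) :
    eulerCoeff Q (k + 1) * (1 - Q * Q ^ k) = eulerCoeff Q k * Q ^ k := by
  have h1 := qFac_self_ne_zero hQ k
  have h2 := one_sub_mul_pow_ne_zero hQ k
  have h3 : qFac Q Q (k + 1) = qFac Q Q k * (1 - Q * Q ^ k) := Finset.prod_range_succ _ _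
  have h4 : (k + 1).choose 2 = k + k.choose 2 := by
    rw [Nat.choose_succ_succ' k 1, Nat.choose_one_right]
  rw [eulerCoeff, eulerCoeff, h3, h4, pow_add, div_mul_eq_mul_div, mul_div_mul_right _ _ h2]
  ring

theorem summable_eulerCoeff {Q : ℂ} (hQ : ‖Q‖ < 1) (z : ℂ) :
    Summable fun k : ℕ => eulerCoeff Q k * z ^ k := by
  have hlim : Tendsto (fun k : ℕ => ‖Q ^ k * z / (1 - Q * Q ^ k)‖) atTop (𝓝 0) := by
    have h := tendsto_pow_atTop_nhds_zero_of_norm_lt_one hQ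
    have h2 : Tendsto (fun k : ℕ => Q ^ k * z / (1 - Q * Q ^ k)) atTop
        (𝓝 (0 * z / (1 - Q * 0))) :=
      (h.mul_const z).div (tendsto_const_nhds.sub (h.const_mul Q)) (by simp)
    simpa using h2.norm
  refine summable_of_ratio_norm_eventually_le (r := 1 / 2) (by norm_num) ?_
  filter_upwards [hlim.eventually_le_const (show (0 : ℝ) < 1 / 2 by norm_num)] with k hk
  have h2 := one_sub_mul_pow_ne_zero hQ k
  have : eulerCoeff Q (k + 1) * z ^ (k + 1) =
      Q ^ k * z / (1 - Q * Q ^ k) * (eulerCoeff Q k * z ^ k) := by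
    rw [eq_div_of_mul_eq h2 (eulerCoeff_succ hQ k)]
    ring
  rw [this, norm_mul]
  gcongr

theorem eulerSum_eq_mul {Q : ℂ} (hQ : ‖Q‖ < 1) (z : ℂ) :
    eulerSum Q z = (1 + z) * eulerSum Q (z * Q) := by
  have h1 := summable_eulerCoeff hQ z
  have h2 := summable_eulerCoeff hQ (z * Q)
  have h : eulerSum Q z - eulerSum Q (z * Q) = z * eulerSum Q (z * Q) := by
    rw [eulerSum, eulerSum, ← h1.tsum_sub h2, (h1.sub h2).tsum_eq_zero_add, ← tsum_mul_left]
    simp only [pow_zero, sub_self, zero_add]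
    refine tsum_congr fun k => ?_
    have := eulerCoeff_succ hQ k
    linear_combination z ^ (k + 1) * this
  linear_combination h

theorem eulerSum_eq_prod_mul {Q : ℂ} (hQ : ‖Q‖ < 1) (z : ℂ) (c : ℕ) :
    eulerSum Q z = (∏ i ∈ Finset.range c, (1 + z * Q ^ i)) * eulerSum Q (z * Q ^ c) := by
  induction c with
  | zero => simp
  | succ c ih =>
    rw [ih, Finset.prod_range_succ, eulerSum_eq_mul hQ (z * Q ^ c)]
    ring_nf

theorem tendsto_eulerSum_mul {Q : ℂ} (hQ : ‖Q‖ < 1) (z : ℂ) {ι : Type*} {l : Filter ι}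
    {x : ι → ℂ} (hx : Tendsto x l (𝓝 0)) :
    Tendsto (fun i => eulerSum Q (z * x i)) l (𝓝 1) := by
  have key : Tendsto (fun i => eulerSum Q (z * x i)) l
      (𝓝 (∑' k : ℕ, eulerCoeff Q k * (z * 0) ^ k)) := by
    refine tendsto_tsum_of_dominated_convergence (summable_eulerCoeff hQ z).norm
      (fun k => ((hx.const_mul z).pow k).const_mul _) ?_
    have : ∀ᶠ i in l, ‖x i‖ ≤ 1 := by
      have h := hx.norm
      rw [norm_zero] at h
      exact h.eventually_le_const one_pos
    filter_upwards [this] with i hi k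
    rw [mul_pow, ← mul_assoc, norm_mul _ (x i ^ k), norm_pow (x i)]
    exact mul_le_of_le_one_right (norm_nonneg _) (pow_le_one₀ (norm_nonneg _) hi)
  have h0 : ∑' k : ℕ, eulerCoeff Q k * (z * 0) ^ k = 1 := by
    rw [tsum_eq_single 0]
    · simp [eulerCoeff_zero]
    · intro k hk
      simp [hk]
  rwa [h0] at key

/-- Euler's expansion of an infinite `q`-rising factorial. -/
theorem eulerSum_eq_qFacInf {Q : ℂ} (hQ : ‖Q‖ < 1) (z : ℂ) : eulerSum Q z = qFacInf (-z) Q := by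
  have h1 := (multipliable_qFacInf (-z) Q hQ).hasProd.tendsto_prod_nat
  have h2 := h1.mul (tendsto_eulerSum_mul hQ z (tendsto_pow_atTop_nhds_zero_of_norm_lt_one hQ))
  rw [mul_one] at h2
  refine tendsto_nhds_unique ?_ h2
  refine tendsto_const_nhds.congr fun c => ?_
  rw [eulerSum_eq_prod_mul hQ z c]
  simp only [neg_mul, sub_neg_eq_add]

/-- A finite product of absolutely convergent series, expanded over all choices of a term from
each factor. -/
theorem hasSum_pi_prod : ∀ {m : ℕ} {f : Fin m → ℕ → ℂ}, (∀ r, Summable (f r)) →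
    HasSum (fun j : Fin m → ℕ => ∏ r, f r (j r)) (∏ r, ∑' k, f r k) := by
  intro m
  induction m with
  | zero =>
    intro f _
    simp
  | succ m ih =>
    intro f hf
    have ih' := ih fun r => hf r.succ
    have hs := summable_mul_of_summable_norm (hf 0).norm ih'.summable.norm
    have h := (hf 0).hasSum.mul ih' hs
    rw [Fin.prod_univ_succ, ← (Fin.consEquiv fun _ => ℕ).hasSum_iff]
    refine h.congr_fun fun p => ?_
    simp [Fin.prod_univ_succ, Fin.consEquiv]

theorem hasSum_det {m : ℕ} {F : Fin m → Fin m → ℕ → ℂ} (hF : ∀ r c, Summable (F r c)) :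
    HasSum (fun j : Fin m → ℕ => (Matrix.of fun r c => F r c (j r)).det)
      (Matrix.of fun r c => ∑' k, F r c k).det := by
  simp only [← Matrix.det_transpose (Matrix.of _), Matrix.det_apply', Matrix.transpose_apply,
    Matrix.of_apply]
  exact hasSum_sum fun σ _ => (hasSum_pi_prod fun r => hF r (σ r)).mul_left _

theorem tsum_eq_sum_residues {m : ℕ} [NeZero m] {f : ℕ → ℂ} (hf : Summable f) :
    ∑' k, f k = ∑ r : Fin m, ∑' j, f (m * j + r) := by
  have h1 : Summable (f ∘ (Nat.divModEquiv m).symm) := (Nat.divModEquiv m).symm.summable_iff.2 hf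
  rw [← (Nat.divModEquiv m).symm.tsum_eq, ← (Equiv.prodComm _ _).tsum_eq,
    Summable.tsum_prod (f := fun p => f ((Nat.divModEquiv m).symm (Equiv.prodComm _ _ p)))
      ((Equiv.prodComm (Fin m) ℕ).summable_iff.2 h1), tsum_fintype]
  simp [mul_comm]

theorem int_two_mul_choose_two (n : ℕ) : 2 * ((n.choose 2 : ℕ) : ℤ) = n * (n - 1) := by
  induction n with
  | zero => simp
  | succ n ih =>
    rw [Nat.choose_succ_succ' n 1, Nat.choose_one_right]
    push_cast
    linear_combination ih

theorem prod_prod_Ioi_pow {m : ℕ} (x : Fin m → ℂ) :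
    ∏ r : Fin m, ∏ s ∈ Finset.Ioi r, x s = ∏ s : Fin m, x s ^ (s : ℕ) := by
  rw [Finset.prod_comm' (t' := Finset.univ) (s' := fun s => Finset.Iio s) (by simp)]
  simp

theorem prod_zpow_eq_zpow_sum {ι : Type*} {Q : ℂ} (hQ0 : Q ≠ 0) (s : Finset ι) (f : ι → ℤ) :
    ∏ i ∈ s, Q ^ f i = Q ^ ∑ i ∈ s, f i := by
  classical
  induction s using Finset.induction_on with
  | empty => simp
  | insert i s hi ih => rw [Finset.prod_insert hi, Finset.sum_insert hi, zpow_add₀ hQ0, ih]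

/-- The summand with its `b`-dependence made explicit. -/
theorem termA_mul (m : ℕ) (Q b w : ℂ) (j : Fin m → ℕ) :
    termA m Q (b * w) j = termA m Q b j * w ^ (m * ∑ r, j r) := by
  simp only [termA, mul_pow]
  ring

theorem one_sub_zpow_ne_zero {Q : ℂ} (hQ0 : Q ≠ 0) (hQ : ‖Q‖ < 1) {k : ℤ} (hk : k < 0) :
    1 - Q ^ k ≠ 0 := by
  refine sub_ne_zero.2 fun h => ?_
  have h1 := congrArg norm h
  rw [norm_one, norm_zpow] at h1
  exact (one_lt_zpow_of_neg₀ (norm_pos_iff.2 hQ0) hQ hk).ne h1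

theorem termA_zero_index (m : ℕ) {Q : ℂ} (hQ0 : Q ≠ 0) (hQ : ‖Q‖ < 1) (b : ℂ) :
    termA m Q b (fun _ => 0) = 1 := by
  have h : vandermondeA m Q (fun _ => 0) = 1 := by
    refine Finset.prod_eq_one fun r _ => Finset.prod_eq_one fun s hs => ?_
    simp only [Nat.cast_zero, sub_self, mul_zero, zero_add]
    have hrs : r < s := Finset.mem_Ioi.1 hs
    exact div_self (one_sub_zpow_ne_zero hQ0 hQ (by omega))
  simp [termA, h, qFac, quadExponent]

/-- The part of the quadratic exponent of a determinant that is independent of the summation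
index. -/
def baseExponent (m r : ℕ) : ℤ := ((r.choose 2 : ℕ) : ℤ) + (2 - m) * r + r * r

theorem sum_exponent (m : ℕ) (j : Fin m → ℕ) :
    ∑ r : Fin m, ((((m * j r + r).choose 2 : ℕ) : ℤ) + (2 - m) * ((m * j r + r : ℕ) : ℤ)
      + (r : ℕ) * ((m * j r + r : ℕ) : ℤ)) =
      ∑ r : Fin m, baseExponent m r + quadExponent m j := by
  simp only [quadExponent, Finset.mul_sum]
  rw [← Finset.sum_sub_distrib, ← Finset.sum_add_distrib, ← Finset.sum_add_distrib]
  refine Finset.sum_congr rfl fun r _ => ?_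
  have h1 := int_two_mul_choose_two (m * j r + r)
  have h2 := int_two_mul_choose_two (m * j r + 1)
  have h3 := int_two_mul_choose_two r
  have h : ∀ x y : ℤ, 2 * x = 2 * y → x = y := fun x y h => by omega
  apply h
  rw [baseExponent]
  push_cast at *
  linear_combination h1 - h2 - h3

/-- The normalising constant relating `termA` to a determinant. -/
noncomputable def normConst (m : ℕ) (Q : ℂ) : ℂ :=
  (∏ r : Fin m, Q ^ baseExponent m r / qFac Q Q r) *
    ∏ r : Fin m, ∏ s ∈ Finset.Ioi r, (1 - Q ^ (((r : ℕ) : ℤ) - ((s : ℕ) : ℤ)))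

theorem prod_one_sub_ne_zero (m : ℕ) {Q : ℂ} (hQ0 : Q ≠ 0) (hQ : ‖Q‖ < 1) :
    ∏ r : Fin m, ∏ s ∈ Finset.Ioi r, (1 - Q ^ (((r : ℕ) : ℤ) - ((s : ℕ) : ℤ))) ≠ 0 := by
  refine Finset.prod_ne_zero_iff.2 fun r _ => Finset.prod_ne_zero_iff.2 fun s hs => ?_
  have hrs : r < s := Finset.mem_Ioi.1 hs
  exact one_sub_zpow_ne_zero hQ0 hQ (by omega)

theorem normConst_ne_zero (m : ℕ) {Q : ℂ} (hQ0 : Q ≠ 0) (hQ : ‖Q‖ < 1) : normConst m Q ≠ 0 :=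
  mul_ne_zero (Finset.prod_ne_zero_iff.2 fun r _ =>
    div_ne_zero (zpow_ne_zero _ hQ0) (qFac_self_ne_zero hQ r)) (prod_one_sub_ne_zero m hQ0 hQ)

theorem vandermondeA_mul (m : ℕ) {Q : ℂ} (hQ0 : Q ≠ 0) (hQ : ‖Q‖ < 1) (j : Fin m → ℕ) :
    vandermondeA m Q j *
        (∏ r : Fin m, ∏ s ∈ Finset.Ioi r, (1 - Q ^ (((r : ℕ) : ℤ) - ((s : ℕ) : ℤ)))) *
        ∏ r : Fin m, (Q ^ (m * j r + r)) ^ (r : ℕ) =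
      (Matrix.vandermonde fun r : Fin m => Q ^ (m * j r + r)).det := by
  rw [Matrix.det_vandermonde, ← prod_prod_Ioi_pow fun r : Fin m => Q ^ (m * j r + r),
    vandermondeA]
  simp only [← Finset.prod_mul_distrib]
  refine Finset.prod_congr rfl fun r _ => Finset.prod_congr rfl fun s hs => ?_
  have hrs : r < s := Finset.mem_Ioi.1 hs
  have hne : 1 - Q ^ (((r : ℕ) : ℤ) - ((s : ℕ) : ℤ)) ≠ 0 :=
    one_sub_zpow_ne_zero hQ0 hQ (by omega)
  rw [div_mul_cancel₀ _ hne, sub_mul, one_mul, ← zpow_natCast, ← zpow_natCast,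
    ← zpow_add₀ hQ0]
  congr 2
  push_cast
  ring

theorem det_eulerCoeff (m : ℕ) {Q : ℂ} (hQ0 : Q ≠ 0) (hQ : ‖Q‖ < 1) (b : ℂ) (j : Fin m → ℕ) :
    (Matrix.of fun r c : Fin m => eulerCoeff Q (m * j r + r) *
        (b * Q ^ (2 - m : ℤ) * Q ^ (c : ℕ)) ^ (m * j r + r)).det =
      normConst m Q * (∏ r : Fin m, b ^ (r : ℕ)) * termA m Q b j := by
  have h1 : (Matrix.of fun r c : Fin m => eulerCoeff Q (m * j r + r) *
        (b * Q ^ (2 - m : ℤ) * Q ^ (c : ℕ)) ^ (m * j r + r)) =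
      Matrix.of fun r c => (eulerCoeff Q (m * j r + r) *
        (b * Q ^ (2 - m : ℤ)) ^ (m * j r + r)) *
          Matrix.vandermonde (fun r : Fin m => Q ^ (m * j r + r)) r c := by
    ext r c
    simp only [Matrix.of_apply, Matrix.vandermonde_apply, mul_pow, ← pow_mul]
    ring
  rw [h1, Matrix.det_mul_column, ← vandermondeA_mul m hQ0 hQ, normConst, termA]
  have h2 : ∏ r : Fin m, (eulerCoeff Q (m * j r + r) *
        (b * Q ^ (2 - m : ℤ)) ^ (m * j r + r) * (Q ^ (m * j r + r)) ^ (r : ℕ)) =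
      (∏ r : Fin m, Q ^ baseExponent m r / qFac Q Q r) * (∏ r : Fin m, b ^ (r : ℕ)) *
      (∏ r : Fin m, 1 / qFac (Q ^ ((r : ℕ) + 1)) Q (m * j r)) * b ^ (m * ∑ r, j r) *
      Q ^ quadExponent m j := by
    have e1 : ∀ r : Fin m, eulerCoeff Q (m * j r + r) *
        (b * Q ^ (2 - m : ℤ)) ^ (m * j r + r) * (Q ^ (m * j r + r)) ^ (r : ℕ) =
        Q ^ ((((m * j r + r).choose 2 : ℕ) : ℤ) + (2 - m) * ((m * j r + r : ℕ) : ℤ)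
          + (r : ℕ) * ((m * j r + r : ℕ) : ℤ)) *
        ((qFac Q Q r)⁻¹ * b ^ (r : ℕ) * (1 / qFac (Q ^ ((r : ℕ) + 1)) Q (m * j r)) *
          b ^ (m * j r)) := by
      intro r
      rw [zpow_add₀ hQ0, zpow_add₀ hQ0, zpow_mul, zpow_natCast, zpow_natCast, eulerCoeff,
        add_comm (m * j r) (r : ℕ), qFac_add, mul_pow, mul_comm ((r : ℕ) : ℤ), zpow_mul,
        zpow_natCast, zpow_natCast, ← pow_succ', pow_add b]
      field_simp
    rw [Finset.prod_congr rfl fun r _ => e1 r, Finset.prod_mul_distrib,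
      prod_zpow_eq_zpow_sum hQ0, sum_exponent, zpow_add₀ hQ0, ← prod_zpow_eq_zpow_sum hQ0,
      Finset.mul_sum, ← Finset.prod_pow_eq_pow_sum]
    simp only [Finset.prod_mul_distrib, div_eq_mul_inv]
    ring
  rw [Finset.prod_mul_distrib] at h2
  linear_combination vandermondeA m Q j *
    (∏ r : Fin m, ∏ s ∈ Finset.Ioi r, (1 - Q ^ (((r : ℕ) : ℤ) - ((s : ℕ) : ℤ)))) * h2

/-- The polynomial `∏_{c ≤ i < m - 1} (1 + Q ^ i X)`. -/
noncomputable def shiftPoly (m : ℕ) (Q : ℂ) (c : ℕ) : Polynomial ℂ :=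
  ∏ i ∈ Finset.range (m - 1 - c), (1 + Polynomial.C (Q ^ (c + i)) * Polynomial.X)

theorem natDegree_shiftPoly_lt {m : ℕ} (hm : 1 ≤ m) (Q : ℂ) (c : ℕ) :
    (shiftPoly m Q c).natDegree < m := by
  have h1 : (shiftPoly m Q c).natDegree ≤ ∑ i ∈ Finset.range (m - 1 - c), 1 := by
    refine (Polynomial.natDegree_prod_le _ _).trans (Finset.sum_le_sum fun i _ => ?_)
    compute_degree
  simp only [Finset.sum_const, Finset.card_range, smul_eq_mul, mul_one] at h1
  omega

theorem eulerSum_mul_pow {m : ℕ} {Q : ℂ} (hQ : ‖Q‖ < 1) (z : ℂ) (c : Fin m) :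
    eulerSum Q (z * Q ^ (c : ℕ)) =
      eulerSum Q (z * Q ^ (m - 1)) *
        ∑ k : Fin m, z ^ (k : ℕ) * (shiftPoly m Q c).coeff k := by
  have hc := c.isLt
  have h1 := Polynomial.eval_eq_sum_range' (natDegree_shiftPoly_lt (show 1 ≤ m by omega) Q c) z
  rw [Finset.sum_range] at h1
  simp only [mul_comm (z ^ _)]
  rw [← h1, eulerSum_eq_prod_mul hQ _ (m - 1 - c), mul_assoc z, ← pow_add,
    show (c : ℕ) + (m - 1 - c) = m - 1 by omega, shiftPoly, Polynomial.eval_prod, mul_comm]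
  congr 1
  refine Finset.prod_congr rfl fun i _ => ?_
  simp only [Polynomial.eval_add, Polynomial.eval_one, Polynomial.eval_mul, Polynomial.eval_C,
    Polynomial.eval_X, pow_add]
  ring

theorem det_residue_eulerSum {m : ℕ} [NeZero m] {Q : ℂ} (hQ : ‖Q‖ < 1) {ζ : ℂ}
    (hζ : IsPrimitiveRoot ζ m) (z : ℂ) :
    (Matrix.of fun r c : Fin m => ∑' j : ℕ, eulerCoeff Q (m * j + r) *
        (z * Q ^ (c : ℕ)) ^ (m * j + r)).det =
      (∏ r : Fin m, z ^ (r : ℕ)) *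
        (Matrix.of fun k c : Fin m => (shiftPoly m Q c).coeff k).det *
        ∏ u : Fin m, eulerSum Q (z * ζ ^ (u : ℕ) * Q ^ (m - 1)) := by
  set M := Matrix.of fun r c : Fin m => ∑' j : ℕ, eulerCoeff Q (m * j + r) *
        (z * Q ^ (c : ℕ)) ^ (m * j + r) with hM
  set K := Matrix.of fun k c : Fin m => (shiftPoly m Q c).coeff k with hK
  set W := Matrix.vandermonde fun u : Fin m => ζ ^ (u : ℕ) with hW
  have hW0 : W.det ≠ 0 := by
    rw [hW, Matrix.det_vandermonde_ne_zero_iff]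
    exact fun u v h => Fin.ext (hζ.pow_inj u.isLt v.isLt h)
  have h1 : W * M = Matrix.of fun u c : Fin m =>
      eulerSum Q (z * ζ ^ (u : ℕ) * Q ^ (m - 1)) *
        ((Matrix.of fun u k : Fin m => z ^ (k : ℕ) * W u k) * K) u c := by
    ext u c
    have h2 : eulerSum Q (z * ζ ^ (u : ℕ) * Q ^ (c : ℕ)) = (W * M) u c := by
      rw [eulerSum, tsum_eq_sum_residues (m := m) (summable_eulerCoeff hQ _), Matrix.mul_apply]
      refine Finset.sum_congr rfl fun r _ => ?_
      rw [hM, hW, Matrix.of_apply, Matrix.vandermonde_apply, ← tsum_mul_left]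
      refine tsum_congr fun j => ?_
      have h3 : (ζ ^ (u : ℕ)) ^ (m * j + r) = (ζ ^ (u : ℕ)) ^ (r : ℕ) := by
        rw [pow_add, pow_mul _ m, ← pow_mul ζ, mul_comm (u : ℕ) m, pow_mul ζ, hζ.pow_eq_one,
          one_pow, one_pow, one_mul]
      rw [← h3]
      simp only [mul_pow]
      ring
    rw [← h2, eulerSum_mul_pow hQ, Matrix.of_apply, Matrix.mul_apply]
    simp only [Matrix.of_apply, hW, hK, Matrix.vandermonde_apply, mul_pow]
  have h4 := congrArg Matrix.det h1
  rw [Matrix.det_mul, Matrix.det_mul_column, Matrix.det_mul, Matrix.det_mul_row] at h4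
  apply mul_left_cancel₀ hW0
  rw [h4]
  ring

theorem prod_one_sub_root_mul {m : ℕ} (hm : 1 ≤ m) {ζ : ℂ} (hζ : IsPrimitiveRoot ζ m) (x : ℂ) :
    ∏ u : Fin m, (1 - ζ ^ (u : ℕ) * x) = 1 - x ^ m := by
  have h := hζ.pow_sub_pow_eq_prod_sub_mul 1 x hm
  rw [one_pow] at h
  rw [h]
  refine Finset.prod_nbij (fun u : Fin m => ζ ^ (u : ℕ)) ?_ ?_ ?_ fun _ _ => rfl
  · intro u _
    rw [Polynomial.mem_nthRootsFinset hm, ← pow_mul, mul_comm, pow_mul, hζ.pow_eq_one, one_pow]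
  · exact fun u _ v _ h => Fin.ext (hζ.pow_inj u.isLt v.isLt h)
  · intro y hy
    rw [Finset.mem_coe, Polynomial.mem_nthRootsFinset hm] at hy
    have : NeZero m := ⟨by omega⟩
    obtain ⟨i, hi, rfl⟩ := hζ.eq_pow_of_pow_eq_one hy
    exact ⟨⟨i, hi⟩, Finset.mem_coe.2 (Finset.mem_univ _), rfl⟩

theorem prod_eulerSum_roots {m : ℕ} (hm : 1 ≤ m) {Q : ℂ} (hQ : ‖Q‖ < 1) {ζ : ℂ}
    (hζ : IsPrimitiveRoot ζ m) (b : ℂ) :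
    ∏ u : Fin m, eulerSum Q (b * ζ ^ (u : ℕ)) = qFacInf ((-b) ^ m) (Q ^ m) := by
  simp only [eulerSum_eq_qFacInf hQ, qFacInf]
  rw [← Multipliable.tprod_finsetProd fun u _ => multipliable_qFacInf _ Q hQ]
  refine tprod_congr fun i => ?_
  have := prod_one_sub_root_mul hm hζ (-b * Q ^ i)
  rw [mul_pow, ← pow_mul Q, mul_comm i, pow_mul] at this
  rw [← this]
  exact Finset.prod_congr rfl fun u _ => by ring

theorem summable_termA {m : ℕ} (hm : 1 ≤ m) {Q : ℂ} (hQ0 : Q ≠ 0) (hQ : ‖Q‖ < 1) (b : ℂ) :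
    Summable (termA m Q b) ∧ normConst m Q * (∏ r : Fin m, b ^ (r : ℕ)) * ∑' j, termA m Q b j =
      (∏ r : Fin m, (b * Q ^ (2 - m : ℤ)) ^ (r : ℕ)) *
        (Matrix.of fun k c : Fin m => (shiftPoly m Q c).coeff k).det *
        qFacInf ((-b * Q) ^ m) (Q ^ m) := by
  have : NeZero m := ⟨by omega⟩
  have key : ∀ b : ℂ, HasSum
      (fun j => normConst m Q * (∏ r : Fin m, b ^ (r : ℕ)) * termA m Q b j)
      ((∏ r : Fin m, (b * Q ^ (2 - m : ℤ)) ^ (r : ℕ)) *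
        (Matrix.of fun k c : Fin m => (shiftPoly m Q c).coeff k).det *
        qFacInf ((-b * Q) ^ m) (Q ^ m)) := by
    intro b
    have hF : ∀ r c : Fin m, Summable fun j : ℕ => eulerCoeff Q (m * j + r) *
        (b * Q ^ (2 - m : ℤ) * Q ^ (c : ℕ)) ^ (m * j + r) := fun r c =>
      (summable_eulerCoeff hQ (b * Q ^ (2 - m : ℤ) * Q ^ (c : ℕ))).comp_injective
        fun i j h => by simpa [NeZero.ne m] using h
    have h := hasSum_det hF
    have hζ := Complex.isPrimitiveRoot_exp m (NeZero.ne m)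
    rw [det_residue_eulerSum hQ hζ] at h
    simp only [det_eulerCoeff m hQ0 hQ] at h
    have hpow : Q ^ (2 - m : ℤ) * Q ^ (m - 1) = Q := by
      rw [← zpow_natCast, ← zpow_add₀ hQ0, Nat.cast_sub hm]
      convert zpow_one Q using 2
      push_cast
      ring
    have hz : ∀ x : ℂ, b * Q ^ (2 - m : ℤ) * x * Q ^ (m - 1) = b * Q * x := fun x => by
      linear_combination (b * x) * hpow
    simp only [hz] at h
    rwa [neg_mul, ← prod_eulerSum_roots hm hQ hζ]
  have hs : ∀ b : ℂ, b ≠ 0 → Summable (termA m Q b) := fun b hb =>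
    (summable_mul_left_iff (mul_ne_zero (normConst_ne_zero m hQ0 hQ)
      (Finset.prod_ne_zero_iff.2 fun r _ => pow_ne_zero _ hb))).1 (key b).summable
  refine ⟨?_, by rw [← tsum_mul_left, (key b).tsum_eq]⟩
  refine ((hs (‖b‖ + 1 : ℝ) (by exact_mod_cast (by positivity : (‖b‖ + 1 : ℝ) ≠ 0))).norm).of_norm_bounded
    fun j => ?_
  have e1 := termA_mul m Q 1 b j
  have e2 := termA_mul m Q 1 (‖b‖ + 1 : ℝ) j
  rw [one_mul] at e1 e2
  rw [e1, e2, norm_mul, norm_mul, norm_pow, norm_pow, Complex.norm_real, Real.norm_of_nonneg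
    (by positivity)]
  gcongr
  linarith

theorem tendsto_qFacInf_pow {m : ℕ} (hm : 1 ≤ m) {Q : ℂ} (hQ : ‖Q‖ < 1) :
    Tendsto (fun b : ℂ => qFacInf ((-b * Q) ^ m) (Q ^ m)) (𝓝 0) (𝓝 1) := by
  have hζ := Complex.isPrimitiveRoot_exp m (by omega : m ≠ 0)
  have h : ∀ b : ℂ, qFacInf ((-b * Q) ^ m) (Q ^ m) = ∏ u : Fin m, eulerSum Q
      (Q * Complex.exp (2 * Real.pi * Complex.I / m) ^ (u : ℕ) * b) := by
    intro b
    rw [neg_mul, ← prod_eulerSum_roots hm hQ hζ]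
    exact Finset.prod_congr rfl fun u _ => by ring_nf
  simp only [h]
  have := tendsto_finsetProd (Finset.univ : Finset (Fin m)) fun u _ =>
    tendsto_eulerSum_mul hQ (Q * Complex.exp (2 * Real.pi * Complex.I / m) ^ (u : ℕ))
      (tendsto_id (α := ℂ) (x := 𝓝 0))
  simpa using this

theorem tsum_termA_zero {m : ℕ} (hm : 1 ≤ m) {Q : ℂ} (hQ0 : Q ≠ 0) (hQ : ‖Q‖ < 1) :
    ∑' j, termA m Q 0 j = 1 := by
  rw [tsum_eq_single (fun _ => 0), termA_zero_index m hQ0 hQ]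
  intro j hj
  have e1 := termA_mul m Q 1 0 j
  rw [mul_zero] at e1
  rw [e1, zero_pow, mul_zero]
  refine mul_ne_zero (by omega) fun h => hj (funext fun r => ?_)
  exact (Finset.sum_eq_zero_iff.1 h) r (Finset.mem_univ _)

theorem tendsto_tsum_termA {m : ℕ} (hm : 1 ≤ m) {Q : ℂ} (hQ0 : Q ≠ 0) (hQ : ‖Q‖ < 1) :
    Tendsto (fun b : ℂ => ∑' j, termA m Q b j) (𝓝 0) (𝓝 1) := by
  have e1 : ∀ (b : ℂ) j, termA m Q b j = termA m Q 1 j * b ^ (m * ∑ r, j r) := fun b j => by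
    rw [← termA_mul, one_mul]
  have key : Tendsto (fun b : ℂ => ∑' j, termA m Q b j) (𝓝 0)
      (𝓝 (∑' j, termA m Q 0 j)) := by
    refine tendsto_tsum_of_dominated_convergence (summable_termA hm hQ0 hQ 1).1.norm
      (fun j => ?_) ?_
    · rw [e1 0 j]
      exact ((tendsto_id.pow _).const_mul (termA m Q 1 j)).congr fun b => (e1 b j).symm
    · filter_upwards [(Metric.ball_mem_nhds (0 : ℂ) one_pos)] with b hb j
      rw [e1, norm_mul, norm_pow]
      rw [mem_ball_zero_iff] at hb
      exact mul_le_of_le_one_right (norm_nonneg _) (pow_le_one₀ (norm_nonneg _) hb.le)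
  rwa [tsum_termA_zero hm hQ0 hQ] at key

/-- The generating function of the type-`A` summands. -/
theorem tsum_termA {m : ℕ} (hm : 1 ≤ m) {Q : ℂ} (hQ0 : Q ≠ 0) (hQ : ‖Q‖ < 1) (b : ℂ) :
    ∑' j, termA m Q b j = qFacInf ((-b * Q) ^ m) (Q ^ m) := by
  have key : ∃ C : ℂ, ∀ b : ℂ, b ≠ 0 →
      ∑' j, termA m Q b j = C * qFacInf ((-b * Q) ^ m) (Q ^ m) := by
    refine ⟨(∏ r : Fin m, (Q ^ (2 - m : ℤ)) ^ (r : ℕ)) *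
      (Matrix.of fun k c : Fin m => (shiftPoly m Q c).coeff k).det / normConst m Q, ?_⟩
    intro b hb
    have h := (summable_termA hm hQ0 hQ b).2
    have h1 := normConst_ne_zero m hQ0 hQ
    have h2 : ∏ r : Fin m, b ^ (r : ℕ) ≠ 0 :=
      Finset.prod_ne_zero_iff.2 fun r _ => pow_ne_zero _ hb
    simp only [mul_pow _ _ (_ : ℕ), Finset.prod_mul_distrib] at h ⊢
    apply mul_left_cancel₀ (mul_ne_zero h1 h2)
    rw [h]
    field_simp
  obtain ⟨C, hC⟩ := key
  have h1 : Tendsto (fun b : ℂ => ∑' j, termA m Q b j) (𝓝[≠] 0) (𝓝 1) :=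
    (tendsto_tsum_termA hm hQ0 hQ).mono_left nhdsWithin_le_nhds
  have h2 : Tendsto (fun b : ℂ => C * qFacInf ((-b * Q) ^ m) (Q ^ m)) (𝓝[≠] 0) (𝓝 (C * 1)) :=
    ((tendsto_qFacInf_pow hm hQ).mono_left nhdsWithin_le_nhds).const_mul C
  have h3 : C * 1 = 1 := by
    refine tendsto_nhds_unique (h2.congr' ?_) h1
    filter_upwards [self_mem_nhdsWithin] with b hb
    exact (hC b hb).symm
  rw [mul_one] at h3
  by_cases hb : b = 0
  · subst hb
    simp [tsum_termA_zero hm hQ0 hQ, qFacInf, zero_pow (show m ≠ 0 by omega)]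
  · rw [hC b hb, h3, one_mul]

theorem qFacInf_ne_zero {A Q : ℂ} (hQ : ‖Q‖ < 1) (h : ∀ i : ℕ, A * Q ^ i ≠ 1) :
    qFacInf A Q ≠ 0 := by
  have hs : Summable fun i : ℕ => ‖-(A * Q ^ i)‖ := by
    simp only [norm_neg, norm_mul, norm_pow]
    exact (summable_geometric_of_lt_one (norm_nonneg Q) hQ).mul_left _
  have := tprod_one_add_ne_zero_of_summable (f := fun i : ℕ => -(A * Q ^ i))
    (fun i => by rw [← sub_eq_add_neg]; exact sub_ne_zero.2 (h i).symm) hs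
  simpa [qFacInf, sub_eq_add_neg] using this

/-- The double series to which both sides of the bibasic identity expand converges absolutely. -/
theorem summable_bibasic {n m : ℕ} (hn : 1 ≤ n) (hm : 1 ≤ m) (a b : ℂ) {p s w : ℂ}
    (hp0 : p ≠ 0) (hp : ‖p‖ < 1) (hs0 : s ≠ 0) (hs : ‖s‖ < 1) (hw : ‖w‖ < 1) :
    Summable fun x : (Fin m → ℕ) × (Fin n → ℕ) =>
      termA m s b x.1 * termA n p (a * w ^ (m * ∑ r, x.1 r)) x.2 := by
  have h := summable_mul_of_summable_norm (summable_termA hm hs0 hs b).1.norm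
    (summable_termA hn hp0 hp a).1.norm
  refine h.norm.of_norm_bounded fun x => ?_
  rw [termA_mul, ← mul_assoc, norm_mul _ ((w ^ _) ^ _)]
  refine mul_le_of_le_one_right (norm_nonneg _) ?_
  rw [← pow_mul, norm_pow]
  exact pow_le_one₀ (norm_nonneg _) hw.le

theorem termA_mul_termA_comm (n m : ℕ) (a b p s w : ℂ) (j : Fin m → ℕ) (k : Fin n → ℕ) :
    termA m s b j * termA n p (a * w ^ (m * ∑ r, j r)) k =
      termA n p a k * termA m s (b * w ^ (n * ∑ r, k r)) j := by
  rw [termA_mul, termA_mul, ← pow_mul, ← pow_mul]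
  ring

/-- One side of the bibasic identity as a double series. -/
theorem summable_and_tsum_bibasic_side {n m : ℕ} (hn : 1 ≤ n) (hm : 1 ≤ m) (a b : ℂ) {p s w : ℂ}
    (hp0 : p ≠ 0) (hp : ‖p‖ < 1) (hs0 : s ≠ 0) (hs : ‖s‖ < 1) (hw : ‖w‖ < 1)
    (hA : ∀ i : ℕ, (-a * p) ^ n * (p ^ n) ^ i ≠ 1) {d : (Fin m → ℕ) → ℂ}
    (hd : ∀ j, d j = qFacInf ((-a * p) ^ n) (p ^ n) /
      qFacInf ((-a * p) ^ n * w ^ (n * m * ∑ r, j r)) (p ^ n)) :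
    Summable (fun j => termA m s b j / d j) ∧
      qFacInf ((-a * p) ^ n) (p ^ n) * ∑' j, termA m s b j / d j =
        ∑' x : (Fin m → ℕ) × (Fin n → ℕ),
          termA m s b x.1 * termA n p (a * w ^ (m * ∑ r, x.1 r)) x.2 := by
  have hpn : ‖p ^ n‖ < 1 := by
    rw [norm_pow]
    exact pow_lt_one₀ (norm_nonneg _) hp (by omega)
  have hA0 := qFacInf_ne_zero hpn hA
  have hsum := summable_bibasic hn hm a b hp0 hp hs0 hs hw
  have hinner : ∀ j : Fin m → ℕ,
      ∑' k, termA m s b j * termA n p (a * w ^ (m * ∑ r, j r)) k =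
        qFacInf ((-a * p) ^ n) (p ^ n) * (termA m s b j / d j) := by
    intro j
    have e : (-(a * w ^ (m * ∑ r, j r)) * p) ^ n =
        (-a * p) ^ n * w ^ (n * m * ∑ r, j r) := by
      rw [mul_assoc n, mul_comm n, pow_mul w _ n, ← mul_pow]
      congr 1
      ring
    rw [tsum_mul_left, tsum_termA hn hp0 hp, e, hd, div_div_eq_mul_div, mul_div_assoc',
      mul_div_cancel_left₀ _ hA0]
  refine ⟨?_, ?_⟩
  · have h := hsum.prod
    simp only [hinner] at h
    exact (summable_mul_left_iff hA0).1 h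
  · rw [hsum.tsum_prod, ← tsum_mul_left]
    exact tsum_congr fun j => (hinner j).symm

/-- The bibasic identity for arbitrary bases `p`, `s` and a coupling parameter `w`. -/
theorem bibasic_identity {n m : ℕ} (hn : 1 ≤ n) (hm : 1 ≤ m) (a b : ℂ) {p s w : ℂ}
    (hp0 : p ≠ 0) (hp : ‖p‖ < 1) (hs0 : s ≠ 0) (hs : ‖s‖ < 1) (hw : ‖w‖ < 1)
    (hA : ∀ i : ℕ, (-a * p) ^ n * (p ^ n) ^ i ≠ 1)
    (hB : ∀ i : ℕ, (-b * s) ^ m * (s ^ m) ^ i ≠ 1)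
    {d : (Fin m → ℕ) → ℂ} {e : (Fin n → ℕ) → ℂ}
    (hd : ∀ j, d j = qFacInf ((-a * p) ^ n) (p ^ n) /
      qFacInf ((-a * p) ^ n * w ^ (n * m * ∑ r, j r)) (p ^ n))
    (he : ∀ k, e k = qFacInf ((-b * s) ^ m) (s ^ m) /
      qFacInf ((-b * s) ^ m * w ^ (m * n * ∑ r, k r)) (s ^ m)) :
    Summable (fun j => termA m s b j / d j) ∧ Summable (fun k => termA n p a k / e k) ∧
      qFacInf ((-a * p) ^ n) (p ^ n) * ∑' j, termA m s b j / d j =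
        qFacInf ((-b * s) ^ m) (s ^ m) * ∑' k, termA n p a k / e k := by
  obtain ⟨h1, h2⟩ := summable_and_tsum_bibasic_side hn hm a b hp0 hp hs0 hs hw hA hd
  obtain ⟨h3, h4⟩ := summable_and_tsum_bibasic_side hm hn b a hs0 hs hp0 hp hw hB he
  refine ⟨h1, h3, ?_⟩
  rw [h2, h4, ← (Equiv.prodComm _ _).tsum_eq]
  exact tsum_congr fun x => termA_mul_termA_comm n m a b p s w x.2 x.1

theorem qPow_mul_natCast (L α : ℂ) (n : ℕ) : qPow L (α * n) = qPow L α ^ n := by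
  rw [qPow, qPow, ← Complex.exp_nat_mul]
  ring_nf

theorem qPow_ne_zero (L α : ℂ) : qPow L α ≠ 0 := Complex.exp_ne_zero _

theorem mainTheorem7 (n m : ℕ) (hn : 1 ≤ n) (hm : 1 ≤ m) (a b : ℂ) :
    -- the bibasic identity, for complex `h` and `t`; here `q = exp L`
    (∀ L h t : ℂ, ‖qPow L h‖ < 1 → ‖qPow L t‖ < 1 → ‖qPow L (h * t)‖ < 1 →
      (∀ i : ℕ, (-a * qPow L h) ^ n * qPow L (h * n) ^ i ≠ 1) →
      (∀ i : ℕ, (-b * qPow L t) ^ m * qPow L (t * m) ^ i ≠ 1) →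
      Summable (fun j : Fin m → ℕ =>
        termA m (qPow L t) b j /
          qFacC L ((-a * qPow L h) ^ n) (h * n) (t * m * ((∑ r, j r : ℕ) : ℂ))) ∧
      Summable (fun k : Fin n → ℕ =>
        termA n (qPow L h) a k /
          qFacC L ((-b * qPow L t) ^ m) (t * m) (h * n * ((∑ r, k r : ℕ) : ℂ))) ∧
      qFacInf ((-a * qPow L h) ^ n) (qPow L (h * n)) *
          ∑' j : Fin m → ℕ, termA m (qPow L t) b j /
            qFacC L ((-a * qPow L h) ^ n) (h * n) (t * m * ((∑ r, j r : ℕ) : ℂ)) =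
        qFacInf ((-b * qPow L t) ^ m) (qPow L (t * m)) *
          ∑' k : Fin n → ℕ, termA n (qPow L h) a k /
            qFacC L ((-b * qPow L t) ^ m) (t * m) (h * n * ((∑ r, k r : ℕ) : ℂ))) ∧
    -- the special case `h = t` with `q` replaced by `q ^ (1 / t)`
    (∀ q L t : ℂ, Complex.exp L = q → ‖q‖ < 1 → ‖qPow L t‖ < 1 →
      (∀ i : ℕ, (-a * q) ^ n * (q ^ n) ^ i ≠ 1) →
      (∀ i : ℕ, (-b * q) ^ m * (q ^ m) ^ i ≠ 1) →
      Summable (fun j : Fin m → ℕ =>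
        termA m q b j / qFacC L ((-a * q) ^ n) n (t * m * ((∑ r, j r : ℕ) : ℂ))) ∧
      Summable (fun k : Fin n → ℕ =>
        termA n q a k / qFacC L ((-b * q) ^ m) m (t * n * ((∑ r, k r : ℕ) : ℂ))) ∧
      qFacInf ((-a * q) ^ n) (q ^ n) *
          ∑' j : Fin m → ℕ, termA m q b j /
            qFacC L ((-a * q) ^ n) n (t * m * ((∑ r, j r : ℕ) : ℂ)) =
        qFacInf ((-b * q) ^ m) (q ^ m) *
          ∑' k : Fin n → ℕ, termA n q a k /
            qFacC L ((-b * q) ^ m) m (t * n * ((∑ r, k r : ℕ) : ℂ))) := by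
  constructor
  · intro L h t hh ht hw hA hB
    have eh := qPow_mul_natCast L h n
    have et := qPow_mul_natCast L t m
    rw [eh] at hA ⊢
    rw [et] at hB ⊢
    refine bibasic_identity hn hm a b (qPow_ne_zero L h) hh (qPow_ne_zero L t) ht hw hA hB
      (fun j => ?_) (fun k => ?_)
    · rw [qFacC, eh, ← qPow_mul_natCast L (h * t)]
      congr 4
      push_cast
      ring
    · rw [qFacC, et, ← qPow_mul_natCast L (h * t)]
      congr 4
      push_cast
      ring
  · intro q L t hq hq1 ht hA hB
    have e1 : ∀ k : ℕ, qPow L k = q ^ k := fun k => by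
      rw [← hq, ← Complex.exp_nat_mul, qPow]
    have hq0 : q ≠ 0 := hq ▸ Complex.exp_ne_zero L
    refine bibasic_identity hn hm a b hq0 hq1 hq0 hq1 ht hA hB (fun j => ?_) (fun k => ?_)
    · rw [qFacC, e1, ← qPow_mul_natCast L t]
      congr 4
      push_cast
      ring
    · rw [qFacC, e1, ← qPow_mul_natCast L t]
      congr 4
      push_cast
      ring
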